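/- Let $\rho,\sigma$ be density matrices (positive semidefinite, trace one) on $\mathbb{C}^{d_1}\otimes\mathbb{C}^{d_2}$. Let $\mathrm{F}(\rho,\sigma)=\operatorname{Tr}\sqrt{\sqrt\rho\,\sigma\sqrt\rho}$ be the fidelity and $$\mathrm{G}_{\min}(\rho,\sigma)=\min_{U_1\in \mathrm{U}(d_1),\,U_2\in \mathrm{U}(d_2)}\mathrm{F}\big(\rho,(U_1\otimes U_2)\sigma(U_1\otimes U_2)^\dagger\big),$$ where $\mathrm{U}(d)$ is the group of $d\times d$ unitary matrices. Then this minimum is attained and $$\mathrm{G}_{\min}(\rho,\sigma)\le\frac{1}{\sqrt{d_1d_2}}\min\big\{\operatorname{Tr}\sqrt\rho,\operatorname{Tr}\sqrt\sigma\big\}.$$ Suppose in addition that $\rho$ and $\sigma$ have full rank $d_1d_2$. Write $\lambda^\downarrow_j$ and $\lambda^\uparrow_j$ for the eigenvalues, counted with multiplicity, in decreasing and increasing order, $\log$ for the natural logarithm, and $\mathrm{S}(\rho\|\sigma)=\operatorname{Tr}\rho(\log\rho-\log\sigma)$ for the quantum relative entropy. Then the maximum of $\mathrm{S}\big(\rho\|(U_1\otimes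 U_2)\sigma(U_1\otimes U_2)^\dagger\big)$ over $U_1\in \mathrm{U}(d_1)$, $U_2\in \mathrm{U}(d_2)$ is attained and $$\mathrm{G}_{\min}(\rho,\sigma)\ge\max\Big\{\operatorname{Tr}\sqrt\rho\;e^{\frac12\sum_{j=1}^{d_1d_2}\lambda^\downarrow_j(\rho)\log\lambda^\uparrow_j(\sigma)},\ \operatorname{Tr}\sqrt\sigma\;e^{\frac12\sum_{j=1}^{d_1d_2}\lambda^\downarrow_j(\sigma)\log\lambda^\uparrow_j(\rho)},\ e^{-\frac12\max_{U_1,U_2}\mathrm{S}(\rho\|(U_1\otimes U_2)\sigma(U_1\otimes U_2)^\dagger)}\Big\}.$$ -/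

import Mathlib

open scoped Kronecker Matrix ComplexOrder

noncomputable section

namespace LocalUnitary

/-- A quantum state (density matrix): positive semidefinite with unit trace. -/
def IsState {ι : Type*} [Fintype ι] (ρ : Matrix ι ι ℂ) : Prop :=
  ρ.PosSemidef ∧ ρ.trace = 1

/-- The eigenvalues are those of a Hermitian matrix. -/
theorem IsState.isHermitian {ι : Type*} [Fintype ι] {ρ : Matrix ι ι ℂ}
    (h : IsState ρ) : ρ.IsHermitian :=
  h.1.isHermitian

/-- The square root of a positive semidefinite matrix, by functional calculus. -/
def msqrt {ι : Type*} [Fintype ι] [DecidableEq ι] (A : Matrix ι ι ℂ) : Matrix ι ι ℂ :=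
  cfc Real.sqrt A

/-- The natural logarithm of a positive definite matrix, by functional calculus. -/
def mlog {ι : Type*} [Fintype ι] [DecidableEq ι] (A : Matrix ι ι ℂ) : Matrix ι ι ℂ :=
  cfc Real.log A

/-- `Tr √ρ`. The trace of a positive semidefinite matrix is a real number, read off as the
real part. -/
def trSqrt {ι : Type*} [Fintype ι] [DecidableEq ι] (ρ : Matrix ι ι ℂ) : ℝ :=
  (msqrt ρ).trace.re

/-- The fidelity `F(ρ, σ) = Tr √(√ρ σ √ρ)` of positive semidefinite matrices. -/
def fidelity {ι : Type*} [Fintype ι] [DecidableEq ι] (ρ σ : Matrix ι ι ℂ) : ℝ :=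
  trSqrt (msqrt ρ * σ * msqrt ρ)

/-- The quantum relative entropy `S(ρ‖σ) = Tr ρ (log ρ - log σ)` of full-rank states
(the trace is then real). -/
def relEntropy {ι : Type*} [Fintype ι] [DecidableEq ι] (ρ σ : Matrix ι ι ℂ) : ℝ :=
  (ρ * (mlog ρ - mlog σ)).trace.re

/-- `λ↓_j`, the eigenvalues with multiplicity in decreasing order. -/
def eigDown {ι : Type*} [Fintype ι] [DecidableEq ι] {A : Matrix ι ι ℂ} (hA : A.IsHermitian)
    (j : Fin (Fintype.card ι)) : ℝ :=
  hA.eigenvalues₀ j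

/-- `λ↑_j`, the eigenvalues with multiplicity in increasing order. -/
def eigUp {ι : Type*} [Fintype ι] [DecidableEq ι] {A : Matrix ι ι ℂ} (hA : A.IsHermitian)
    (j : Fin (Fintype.card ι)) : ℝ :=
  hA.eigenvalues₀ j.rev

/-- `(U₁ ⊗ U₂) σ (U₁ ⊗ U₂)†`. -/
def localConj {d₁ d₂ : ℕ}
    (U : Matrix.unitaryGroup (Fin d₁) ℂ × Matrix.unitaryGroup (Fin d₂) ℂ)
    (σ : Matrix (Fin d₁ × Fin d₂) (Fin d₁ × Fin d₂) ℂ) :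
    Matrix (Fin d₁ × Fin d₂) (Fin d₁ × Fin d₂) ℂ :=
  ((U.1 : Matrix (Fin d₁) (Fin d₁) ℂ) ⊗ₖ (U.2 : Matrix (Fin d₂) (Fin d₂) ℂ)) * σ *
    ((U.1 : Matrix (Fin d₁) (Fin d₁) ℂ) ⊗ₖ (U.2 : Matrix (Fin d₂) (Fin d₂) ℂ))ᴴ

/-- The values `F(ρ, (U₁ ⊗ U₂) σ (U₁ ⊗ U₂)†)` over all local unitaries. -/
def fidelityValues {d₁ d₂ : ℕ}
    (ρ σ : Matrix (Fin d₁ × Fin d₂) (Fin d₁ × Fin d₂) ℂ) : Set ℝ :=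
  Set.range fun U : Matrix.unitaryGroup (Fin d₁) ℂ × Matrix.unitaryGroup (Fin d₂) ℂ =>
    fidelity ρ (localConj U σ)

/-- The values `S(ρ‖(U₁ ⊗ U₂) σ (U₁ ⊗ U₂)†)` over all local unitaries. -/
def relEntropyValues {d₁ d₂ : ℕ}
    (ρ σ : Matrix (Fin d₁ × Fin d₂) (Fin d₁ × Fin d₂) ℂ) : Set ℝ :=
  Set.range fun U : Matrix.unitaryGroup (Fin d₁) ℂ × Matrix.unitaryGroup (Fin d₂) ℂ =>
    relEntropy ρ (localConj U σ)

/-- `G_min(ρ, σ)`, the least fidelity under local unitaries. -/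
def Gmin {d₁ d₂ : ℕ} (ρ σ : Matrix (Fin d₁ × Fin d₂) (Fin d₁ × Fin d₂) ℂ) : ℝ :=
  sInf (fidelityValues ρ σ)

/-- The greatest relative entropy under local unitaries. -/
def maxRelEntropy {d₁ d₂ : ℕ}
    (ρ σ : Matrix (Fin d₁ × Fin d₂) (Fin d₁ × Fin d₂) ℂ) : ℝ :=
  sSup (relEntropyValues ρ σ)

end LocalUnitary

end

/-!
Write `σ' = W σ Wᴴ` with `W = U₁ ⊗ U₂`. The local unitaries form a compact group, and both the
fidelity (by continuity of the functional calculus in the matrix) and the relative entropy (since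
`log σ' = W (log σ) Wᴴ`) depend continuously on them, so the extrema are attained.

*Upper bound.* `A ↦ Tr √A` is concave (`sum_mul_trSqrt_le`), hence so is the fidelity in its second
argument. Averaging `σ'` over products of Weyl operators, which form unitary one-designs, gives the
maximally mixed state (`IsOneDesign.sum_kronecker_conj`), whose fidelity with `ρ` is
`Tr √ρ / √(d₁ d₂)`; some `σ'` does no better than the average. The bound with `Tr √σ` follows since
`F(ρ, σ)` only depends on the characteristic polynomial of `ρ * σ`, which makes `Gmin` symmetric.

*Lower bounds.* The fidelity is the trace norm of `√σ' √ρ`, so `F(ρ, σ') ≥ Tr √ρ √σ'`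
(`re_trace_msqrt_mul_msqrt_le_fidelity`). If `p` and `s` are the eigenvalues of `ρ` and `σ`, then
`Tr √ρ √σ' = ∑ Pᵢⱼ √pᵢ √sⱼ` for the doubly stochastic matrix `P` of transition probabilities between
the two eigenbases. Convexity of `exp`, with weights proportional to `Pᵢⱼ √pᵢ`, bounds this below by
`Tr √ρ` times the exponential of half the mean of `log sⱼ`; Birkhoff's theorem and the rearrangement
inequality, followed by Chebyshev's inequality, bound that mean below by the oppositely ordered sum
(`trSqrt_mul_exp_le_re_trace`). With the weights `Pᵢⱼ pᵢ` instead, the same convexity argument yields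
the relative entropy (`exp_neg_relEntropy_le_re_trace`).
-/

namespace LocalUnitary

/-! ### Scalar inequalities -/

/-- Weighted Chebyshev inequality, with the entries of `q` as weights of `q` and `x`. -/
theorem sum_mul_sum_sq_mul_le_of_antivary {κ : Type*} [Fintype κ] {q x : κ → ℝ}
    (hq : ∀ k, 0 ≤ q k) (h : Antivary q x) :
    (∑ k, q k) * ∑ k, q k ^ 2 * x k ≤ (∑ k, q k ^ 2) * ∑ k, q k * x k := by
  have key : 0 ≤ ∑ k, ∑ l, q k * q l * ((q l - q k) * (x k - x l)) := by
    refine Finset.sum_nonneg fun k _ => Finset.sum_nonneg fun l _ =>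
      mul_nonneg (mul_nonneg (hq k) (hq l)) ?_
    rcases lt_trichotomy (x k) (x l) with hx | hx | hx
    · exact mul_nonneg_of_nonpos_of_nonpos (sub_nonpos.2 (h hx)) (sub_nonpos.2 hx.le)
    · simp [hx]
    · exact mul_nonneg (sub_nonneg.2 (h hx)) (sub_nonneg.2 hx.le)
  have e : ∑ k, ∑ l, q k * q l * ((q l - q k) * (x k - x l)) =
      ((∑ k, q k ^ 2) * (∑ k, q k * x k) - (∑ k, q k) * ∑ k, q k ^ 2 * x k) +
      ((∑ k, q k * x k) * (∑ k, q k ^ 2) - (∑ k, q k ^ 2 * x k) * ∑ k, q k) := by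
    simp only [Finset.sum_mul_sum]
    simp only [← Finset.sum_sub_distrib, ← Finset.sum_add_distrib]
    exact Finset.sum_congr rfl fun k _ => Finset.sum_congr rfl fun l _ => by ring
  rw [e] at key
  nlinarith [key]

/-- By Birkhoff's theorem a doubly stochastic pairing is a convex combination of pairings by
permutations, and the rearrangement inequality bounds each of those below by the oppositely ordered
pairing. -/
theorem sum_mul_rev_le_of_mem_doublyStochastic {n : Type*} [Fintype n] [DecidableEq n] {N : ℕ}
    {P : Matrix n n ℝ} (hP : P ∈ doublyStochastic ℝ n) (e : n ≃ Fin N) {q x : Fin N → ℝ}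
    (hq : Antitone q) (hx : Antitone x) :
    ∑ k, q k * x k.rev ≤ ∑ i, ∑ j, P i j * (q (e i) * x (e j)) := by
  obtain ⟨w, hw, hw1, rfl⟩ := exists_eq_sum_perm_of_mem_doublyStochastic hP
  have hav : Antivary q (fun k => x k.rev) := by
    have : Monotone fun k : Fin N => x k.rev := fun a b hab => hx (Fin.rev_le_rev.2 hab)
    exact hq.antivary this
  have hperm (π : Equiv.Perm n) :
      ∑ k, q k * x k.rev ≤ ∑ i, q (e i) * x (e (π i)) := by
    have := hav.sum_mul_le_sum_mul_comp_perm
      (σ := (e.symm.trans (π.trans e)).trans Fin.revPerm)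
    refine this.trans_eq ?_
    rw [← e.sum_comp]
    simp
  calc ∑ k, q k * x k.rev = ∑ π, w π * ∑ k, q k * x k.rev := by
        rw [← Finset.sum_mul, hw1, one_mul]
    _ ≤ ∑ π, w π * ∑ i, q (e i) * x (e (π i)) :=
        Finset.sum_le_sum fun π _ => mul_le_mul_of_nonneg_left (hperm π) (hw π)
    _ = _ := by
        simp only [Matrix.sum_apply, Matrix.smul_apply, smul_eq_mul, Finset.sum_mul,
          Finset.mul_sum]
        rw [Finset.sum_comm]
        refine Finset.sum_congr rfl fun i _ => ?_
        rw [Finset.sum_comm]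
        refine Finset.sum_congr rfl fun π _ => ?_
        simp [Equiv.Perm.permMatrix, PEquiv.toMatrix_apply, Equiv.toPEquiv_apply, eq_comm]

/-- Jensen's inequality for `exp`, with weights indexed by pairs. -/
theorem exp_sum_sum_le {n m : Type*} [Fintype n] [Fintype m] {w x : n → m → ℝ}
    (hw : ∀ i j, 0 ≤ w i j) (hw1 : ∑ i, ∑ j, w i j = 1) :
    Real.exp (∑ i, ∑ j, w i j * x i j) ≤ ∑ i, ∑ j, w i j * Real.exp (x i j) := by
  have := convexOn_exp.map_sum_le (t := Finset.univ) (w := fun p : n × m => w p.1 p.2)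
    (p := fun p => x p.1 p.2) (fun p _ => hw _ _) (by rw [Fintype.sum_prod_type]; exact hw1)
    (fun _ _ => Set.mem_univ _)
  simpa only [Fintype.sum_prod_type, smul_eq_mul] using this

theorem sqrt_eq_exp_half_log {s : ℝ} (hs : 0 < s) : √s = Real.exp (1 / 2 * Real.log s) := by
  rw [Real.sqrt_eq_rpow, Real.rpow_def_of_pos hs, mul_comm]

/-! ### Unitary overlaps -/

/-- The squared moduli of the entries of a matrix. For `W = Uᴴ * V` with `U`, `V` unitary these
are the transition probabilities between the two orthonormal bases. -/
def normSqMatrix {n : Type*} (W : Matrix n n ℂ) : Matrix n n ℝ :=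
  Matrix.of fun i j => Complex.normSq (W i j)

section Matrices

variable {n : Type*} [Fintype n] [DecidableEq n]

theorem normSqMatrix_mem_doublyStochastic {W : Matrix n n ℂ} (hW : W ∈ Matrix.unitaryGroup n ℂ) :
    normSqMatrix W ∈ doublyStochastic ℝ n := by
  rw [mem_doublyStochastic_iff_sum]
  refine ⟨fun i j => Complex.normSq_nonneg _, fun i => ?_, fun j => ?_⟩
  · have h := congrFun (congrFun (Matrix.mem_unitaryGroup_iff.1 hW) i) i
    rw [Matrix.mul_apply, Matrix.one_apply_eq] at h
    simp only [Matrix.star_apply, RCLike.star_def, Complex.mul_conj] at h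
    exact_mod_cast h
  · have h := congrFun (congrFun (Matrix.mem_unitaryGroup_iff'.1 hW) j) j
    rw [Matrix.mul_apply, Matrix.one_apply_eq] at h
    simp only [Matrix.star_apply, RCLike.star_def, ← Complex.normSq_eq_conj_mul_self] at h
    exact_mod_cast h

theorem trace_conj_diagonal_mul_conj_diagonal (U V : Matrix n n ℂ) (a b : n → ℝ) :
    ((U * Matrix.diagonal (fun i => (a i : ℂ)) * Uᴴ) *
      (V * Matrix.diagonal (fun i => (b i : ℂ)) * Vᴴ)).trace.re =
      ∑ i, ∑ j, normSqMatrix (Uᴴ * V) i j * (a i * b j) := by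
  have h : ((U * Matrix.diagonal (fun i => (a i : ℂ)) * Uᴴ) *
      (V * Matrix.diagonal (fun i => (b i : ℂ)) * Vᴴ)).trace =
      (Matrix.diagonal (fun i => (a i : ℂ)) * (Uᴴ * V) *
        (Matrix.diagonal (fun i => (b i : ℂ)) * (Uᴴ * V)ᴴ)).trace := by
    rw [Matrix.conjTranspose_mul, Matrix.conjTranspose_conjTranspose, Matrix.mul_assoc,
      Matrix.mul_assoc, Matrix.trace_mul_comm]
    simp only [Matrix.mul_assoc]
  rw [h, Matrix.trace]
  simp only [Matrix.diag_apply, Matrix.mul_apply (M := _ * _) (N := _ * _),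
    Matrix.diagonal_mul, Complex.re_sum]
  refine Finset.sum_congr rfl fun i _ => Finset.sum_congr rfl fun j _ => ?_
  rw [Matrix.conjTranspose_apply, RCLike.star_def, mul_mul_mul_comm,
    Complex.mul_conj, normSqMatrix, Matrix.of_apply, ← Complex.ofReal_mul, ← Complex.ofReal_mul,
    Complex.ofReal_re, mul_comm]

/-! ### Functional calculus and unitary conjugation -/

theorem cfc_unitary_conj {A W : Matrix n n ℂ} (hA : A.IsHermitian)
    (hW : W ∈ Matrix.unitaryGroup n ℂ) (f : ℝ → ℝ) :
    cfc f (W * A * Wᴴ) = W * cfc f A * Wᴴ := by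
  have h := StarAlgHomClass.map_cfc (S := ℂ)
    (Unitary.conjStarAlgAut ℂ (Matrix n n ℂ) ⟨W, hW⟩) f A
    (A.finite_real_spectrum.continuousOn f)
    (by
      change Continuous fun x => W * x * star W
      fun_prop)
    hA (by
      change IsSelfAdjoint (W * A * star W)
      exact hA.isSelfAdjoint.conjugate W)
  exact h.symm

/-- The diagonal form of the functional calculus of a unitarily conjugated matrix. -/
theorem cfc_unitary_conj_eq_diagonal {A W : Matrix n n ℂ} (hA : A.IsHermitian)
    (hW : W ∈ Matrix.unitaryGroup n ℂ) (f : ℝ → ℝ) :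
    cfc f (W * A * Wᴴ) = (W * (hA.eigenvectorUnitary : Matrix n n ℂ)) *
      Matrix.diagonal (fun i => (f (hA.eigenvalues i) : ℂ)) *
        (W * (hA.eigenvectorUnitary : Matrix n n ℂ))ᴴ := by
  rw [cfc_unitary_conj hA hW, hA.cfc_eq f, Matrix.IsHermitian.cfc, Unitary.conjStarAlgAut_apply,
    Matrix.conjTranspose_mul]
  simp only [Matrix.mul_assoc]
  rfl

theorem cfc_eq_diagonal {A : Matrix n n ℂ} (hA : A.IsHermitian) (f : ℝ → ℝ) :
    cfc f A = (hA.eigenvectorUnitary : Matrix n n ℂ) *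
      Matrix.diagonal (fun i => (f (hA.eigenvalues i) : ℂ)) *
        (hA.eigenvectorUnitary : Matrix n n ℂ)ᴴ := by
  simpa using cfc_unitary_conj_eq_diagonal hA (one_mem (Matrix.unitaryGroup n ℂ)) f

theorem eq_diagonal {A : Matrix n n ℂ} (hA : A.IsHermitian) :
    A = (hA.eigenvectorUnitary : Matrix n n ℂ) *
      Matrix.diagonal (fun i => (hA.eigenvalues i : ℂ)) *
        (hA.eigenvectorUnitary : Matrix n n ℂ)ᴴ := by
  conv_lhs => rw [hA.spectral_theorem]
  rfl

theorem isHermitian_cfc (A : Matrix n n ℂ) (f : ℝ → ℝ) : (cfc f A).IsHermitian :=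
  cfc_predicate f A

theorem msqrt_mul_msqrt {A : Matrix n n ℂ} (hA : A.PosSemidef) : msqrt A * msqrt A = A := by
  have hs : ∀ i, (√(hA.isHermitian.eigenvalues i) : ℂ) * (√(hA.isHermitian.eigenvalues i) : ℂ) =
      (hA.isHermitian.eigenvalues i : ℂ) := fun i => by
    rw [← Complex.ofReal_mul, Real.mul_self_sqrt (hA.eigenvalues_nonneg i)]
  rw [msqrt, cfc_eq_diagonal hA.isHermitian]
  have hu := Matrix.mem_unitaryGroup_iff'.1 hA.isHermitian.eigenvectorUnitary.2
  rw [Matrix.star_eq_conjTranspose] at hu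
  conv_rhs => rw [eq_diagonal hA.isHermitian]
  simp only [Matrix.mul_assoc]
  rw [← Matrix.mul_assoc (_ᴴ) _ (_ * _), hu, Matrix.one_mul, ← Matrix.mul_assoc (Matrix.diagonal _),
    Matrix.diagonal_mul_diagonal]
  simp only [hs]

theorem trSqrt_eq_sum {A : Matrix n n ℂ} (hA : A.IsHermitian) :
    trSqrt A = ∑ i, √(hA.eigenvalues i) := by
  rw [trSqrt, msqrt, cfc_eq_diagonal hA, Matrix.trace_mul_comm, ← Matrix.mul_assoc,
    ← Matrix.star_eq_conjTranspose,
    Matrix.mem_unitaryGroup_iff'.1 hA.eigenvectorUnitary.2, Matrix.one_mul, Matrix.trace_diagonal,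
    Complex.re_sum]
  simp

/-- `Tr √A` depends only on the spectrum of `A` with multiplicities. -/
theorem trSqrt_eq_of_charpoly_eq {A B : Matrix n n ℂ} (hA : A.IsHermitian) (hB : B.IsHermitian)
    (h : A.charpoly = B.charpoly) : trSqrt A = trSqrt B := by
  rw [trSqrt_eq_sum hA, trSqrt_eq_sum hB, (hA.eigenvalues_eq_eigenvalues_iff hB).2 h]

theorem trSqrt_smul {A : Matrix n n ℂ} (hA : A.IsHermitian) {c : ℝ} (hc : 0 ≤ c) :
    trSqrt (c • A) = √c * trSqrt A := by
  have h : cfc Real.sqrt (c • A) = cfc (fun x => √(c • x)) A :=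
    (cfc_comp_smul c Real.sqrt A (by fun_prop) hA).symm
  rw [trSqrt, msqrt, h]
  simp only [smul_eq_mul, Real.sqrt_mul hc]
  rw [cfc_const_mul _ _ _ (by fun_prop), Matrix.trace_smul, Complex.smul_re, smul_eq_mul]
  rfl

/-! ### The trace norm, concavity, and the fidelity -/

/-- The trace is dominated by the trace norm: in an eigenbasis of `Xᴴ * X` each diagonal entry of
`X` is bounded by the length of its column, a singular value. -/
theorem re_trace_le_trSqrt_conjTranspose_mul_self (X : Matrix n n ℂ) :
    X.trace.re ≤ trSqrt (Xᴴ * X) := by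
  have hA := Matrix.isHermitian_conjTranspose_mul_self X
  set V : Matrix n n ℂ := (hA.eigenvectorUnitary : Matrix n n ℂ) with hV
  have hVV : V * Vᴴ = 1 := Matrix.mem_unitaryGroup_iff.1 hA.eigenvectorUnitary.2
  have hVV' : Vᴴ * V = 1 := Matrix.mem_unitaryGroup_iff'.1 hA.eigenvectorUnitary.2
  set Z := Vᴴ * X * V with hZ
  have htr : Z.trace = X.trace := by
    rw [hZ, Matrix.mul_assoc, Matrix.trace_mul_comm, Matrix.mul_assoc, hVV, Matrix.mul_one]
  have hZZ : Zᴴ * Z = Matrix.diagonal (fun i => (hA.eigenvalues i : ℂ)) := by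
    have h1 : Zᴴ * Z = Vᴴ * (Xᴴ * X) * V := by
      rw [hZ]
      simp only [Matrix.conjTranspose_mul, Matrix.conjTranspose_conjTranspose, Matrix.mul_assoc]
      rw [← Matrix.mul_assoc V Vᴴ, hVV, Matrix.one_mul]
    rw [h1]
    conv_lhs => rw [eq_diagonal hA]
    rw [← hV, Matrix.mul_assoc, Matrix.mul_assoc, Matrix.mul_assoc, hVV', Matrix.mul_one,
      ← Matrix.mul_assoc, hVV', Matrix.one_mul]
  rw [← htr, trSqrt_eq_sum hA, Matrix.trace, Complex.re_sum]
  refine Finset.sum_le_sum fun i _ => Real.le_sqrt_of_sq_le ?_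
  have h := congrFun (congrFun hZZ i) i
  rw [Matrix.mul_apply, Matrix.diagonal_apply_eq] at h
  simp only [Matrix.conjTranspose_apply, RCLike.star_def, ← Complex.normSq_eq_conj_mul_self] at h
  have h : ∑ k, Complex.normSq (Z k i) = hA.eigenvalues i := by exact_mod_cast h
  calc (Z.diag i).re ^ 2 ≤ Complex.normSq (Z i i) := by
        rw [Complex.normSq_apply, Matrix.diag_apply]
        nlinarith [mul_self_nonneg (Z i i).im]
    _ ≤ ∑ k, Complex.normSq (Z k i) :=
        Finset.single_le_sum (f := fun k => Complex.normSq (Z k i))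
          (fun k _ => Complex.normSq_nonneg _) (Finset.mem_univ i)
    _ = _ := h

/-- Pinching: the eigenvalues of `A` are more spread out than its diagonal entries in any
orthonormal basis, and the square root is concave. -/
theorem trSqrt_le_sum_sqrt_diag {A V : Matrix n n ℂ} (hA : A.PosSemidef)
    (hV : V ∈ Matrix.unitaryGroup n ℂ) :
    trSqrt A ≤ ∑ i, √((Vᴴ * A * V) i i).re := by
  set U : Matrix n n ℂ := (hA.isHermitian.eigenvectorUnitary : Matrix n n ℂ) with hU
  have hP := normSqMatrix_mem_doublyStochastic
    (mul_mem (Unitary.star_mem hV) hA.isHermitian.eigenvectorUnitary.2)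
  rw [← hU, Matrix.star_eq_conjTranspose] at hP
  set P := normSqMatrix (Vᴴ * U) with hPd
  have hd (i : n) : ((Vᴴ * A * V) i i).re = ∑ j, P i j * hA.isHermitian.eigenvalues j := by
    have : Vᴴ * A * V = (Vᴴ * U) * Matrix.diagonal (fun i => (hA.isHermitian.eigenvalues i : ℂ)) *
        (Vᴴ * U)ᴴ := by
      conv_lhs => rw [eq_diagonal hA.isHermitian]
      simp only [Matrix.conjTranspose_mul, Matrix.conjTranspose_conjTranspose, Matrix.mul_assoc,
        ← hU]
    rw [this, Matrix.mul_apply, Complex.re_sum]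
    refine Finset.sum_congr rfl fun j _ => ?_
    rw [Matrix.mul_diagonal, Matrix.conjTranspose_apply, RCLike.star_def, mul_right_comm,
      Complex.mul_conj, ← Complex.ofReal_mul, Complex.ofReal_re, hPd, normSqMatrix,
      Matrix.of_apply]
  calc trSqrt A = ∑ j, ∑ i, P i j * √(hA.isHermitian.eigenvalues j) := by
        rw [trSqrt_eq_sum hA.isHermitian]
        refine Finset.sum_congr rfl fun j _ => ?_
        rw [← Finset.sum_mul, sum_col_of_mem_doublyStochastic hP, one_mul]
    _ = ∑ i, ∑ j, P i j * √(hA.isHermitian.eigenvalues j) := Finset.sum_comm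
    _ ≤ _ := by
        refine Finset.sum_le_sum fun i _ => ?_
        rw [hd]
        exact Real.strictConcaveOn_sqrt.concaveOn.le_map_sum
          (fun j _ => nonneg_of_mem_doublyStochastic hP)
          (sum_row_of_mem_doublyStochastic hP i) (fun j _ => hA.eigenvalues_nonneg j)

/-- `A ↦ Tr √A` is concave on positive semidefinite matrices. -/
theorem sum_mul_trSqrt_le {κ : Type*} [Fintype κ] {w : κ → ℝ} {A : κ → Matrix n n ℂ}
    (hw : ∀ k, 0 ≤ w k) (hw1 : ∑ k, w k = 1) (hA : ∀ k, (A k).PosSemidef) :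
    ∑ k, w k * trSqrt (A k) ≤ trSqrt (∑ k, w k • A k) := by
  have hM : (∑ k, w k • A k).IsHermitian := by
    rw [Matrix.IsHermitian, Matrix.conjTranspose_sum]
    refine Finset.sum_congr rfl fun k _ => ?_
    rw [Matrix.conjTranspose_smul, (hA k).isHermitian.eq, star_trivial]
  set V : Matrix n n ℂ := (hM.eigenvectorUnitary : Matrix n n ℂ) with hV
  have hVV : Vᴴ * V = 1 := Matrix.mem_unitaryGroup_iff'.1 hM.eigenvectorUnitary.2
  have hd (i : n) : hM.eigenvalues i = ∑ k, w k * ((Vᴴ * A k * V) i i).re := by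
    have h1 : Vᴴ * (∑ k, w k • A k) * V = Matrix.diagonal (fun i => (hM.eigenvalues i : ℂ)) := by
      conv_lhs => rw [eq_diagonal hM]
      rw [← hV, Matrix.mul_assoc, Matrix.mul_assoc, Matrix.mul_assoc, hVV, Matrix.mul_one,
        ← Matrix.mul_assoc, hVV, Matrix.one_mul]
    have h2 := congrArg Complex.re (congrFun (congrFun h1 i) i)
    rw [Matrix.diagonal_apply_eq, Complex.ofReal_re] at h2
    rw [← h2, Matrix.mul_sum, Matrix.sum_mul, Matrix.sum_apply, Complex.re_sum]
    refine Finset.sum_congr rfl fun k _ => ?_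
    rw [Matrix.mul_smul, Matrix.smul_mul, Matrix.smul_apply, Complex.smul_re, smul_eq_mul]
  have hpos (k : κ) (i : n) : 0 ≤ ((Vᴴ * A k * V) i i).re :=
    (Complex.nonneg_iff.1 (((hA k).conjTranspose_mul_mul_same V).diag_nonneg (i := i))).1
  calc ∑ k, w k * trSqrt (A k) ≤ ∑ k, w k * ∑ i, √((Vᴴ * A k * V) i i).re :=
        Finset.sum_le_sum fun k _ => mul_le_mul_of_nonneg_left
          (trSqrt_le_sum_sqrt_diag (hA k) hM.eigenvectorUnitary.2) (hw k)
    _ = ∑ i, ∑ k, w k * √((Vᴴ * A k * V) i i).re := by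
        simp only [Finset.mul_sum]
        exact Finset.sum_comm
    _ ≤ _ := by
        rw [trSqrt_eq_sum hM]
        refine Finset.sum_le_sum fun i _ => ?_
        rw [hd]
        exact Real.strictConcaveOn_sqrt.concaveOn.le_map_sum (fun k _ => hw k) hw1
          (fun k _ => hpos k i)

theorem posSemidef_msqrt_mul_mul_msqrt (ρ : Matrix n n ℂ) {σ : Matrix n n ℂ} (hσ : σ.PosSemidef) :
    (msqrt ρ * σ * msqrt ρ).PosSemidef := by
  have := hσ.mul_mul_conjTranspose_same (msqrt ρ)
  rwa [show (msqrt ρ)ᴴ = msqrt ρ from isHermitian_cfc ρ Real.sqrt] at this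

theorem re_trace_msqrt_mul_msqrt_le_fidelity (ρ : Matrix n n ℂ) {σ : Matrix n n ℂ}
    (hσ : σ.PosSemidef) : (msqrt ρ * msqrt σ).trace.re ≤ fidelity ρ σ := by
  have h := re_trace_le_trSqrt_conjTranspose_mul_self (msqrt σ * msqrt ρ)
  have hr : (msqrt ρ)ᴴ = msqrt ρ := isHermitian_cfc ρ Real.sqrt
  have hs : (msqrt σ)ᴴ = msqrt σ := isHermitian_cfc σ Real.sqrt
  rw [Matrix.conjTranspose_mul, hr, hs, Matrix.trace_mul_comm, Matrix.mul_assoc,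
    ← Matrix.mul_assoc (msqrt σ), msqrt_mul_msqrt hσ, ← Matrix.mul_assoc] at h
  exact h

theorem charpoly_msqrt_mul_mul_msqrt {ρ : Matrix n n ℂ} (hρ : ρ.PosSemidef) (σ : Matrix n n ℂ) :
    (msqrt ρ * σ * msqrt ρ).charpoly = (ρ * σ).charpoly := by
  rw [Matrix.charpoly_mul_comm, ← Matrix.mul_assoc, msqrt_mul_msqrt hρ]

/-- The fidelity of `ρ` and `σ` depends only on the characteristic polynomial of `ρ * σ`, which
makes it symmetric and unitarily invariant. -/
theorem fidelity_eq_of_charpoly_eq {ρ σ ρ' σ' : Matrix n n ℂ} (hρ : ρ.PosSemidef)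
    (hσ : σ.PosSemidef) (hρ' : ρ'.PosSemidef) (hσ' : σ'.PosSemidef)
    (h : (ρ * σ).charpoly = (ρ' * σ').charpoly) : fidelity ρ σ = fidelity ρ' σ' :=
  trSqrt_eq_of_charpoly_eq (posSemidef_msqrt_mul_mul_msqrt ρ hσ).isHermitian
    (posSemidef_msqrt_mul_mul_msqrt ρ' hσ').isHermitian
    (by rw [charpoly_msqrt_mul_mul_msqrt hρ, charpoly_msqrt_mul_mul_msqrt hρ', h])

open scoped Matrix.Norms.L2Operator in
theorem continuous_trSqrt_comp {T : Type*} [TopologicalSpace T] {A : T → Matrix n n ℂ}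
    (hA : Continuous A) (hA' : ∀ t, (A t).IsHermitian) : Continuous fun t => trSqrt (A t) := by
  have h : Continuous fun t => cfc Real.sqrt (A t) :=
    Continuous.cfc_of_mem_nhdsSet Real.sqrt Filter.univ_mem hA (fun t => (hA' t).isSelfAdjoint)
      Real.continuous_sqrt.continuousOn
  exact Complex.continuous_re.comp h.matrix_trace

instance compactSpace_unitaryGroup : CompactSpace (Matrix.unitaryGroup n ℂ) := by
  refine isCompact_iff_compactSpace.1 ?_
  have hK : IsCompact (Set.univ.pi fun _ : n => Set.univ.pi fun _ : n =>
      Metric.closedBall (0 : ℂ) 1) :=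
    isCompact_univ_pi fun _ => isCompact_univ_pi fun _ => isCompact_closedBall _ _
  refine IsCompact.of_isClosed_subset hK (isClosed_unitary (R := Matrix n n ℂ)) ?_
  intro U hU i _ j _
  simpa using entry_norm_bound_of_unitary hU i j

end Matrices

/-! ### Twirling -/

/-- A finite family of matrices with the first moments of a Haar random unitary, up to the
factor `K`: summing `U X Uᴴ` over the family gives `K * Tr X` times the identity. -/
def IsOneDesign {n κ : Type*} [Fintype κ] [DecidableEq n] (U : κ → Matrix n n ℂ) (K : ℂ) : Prop :=
  ∀ a b c e, ∑ k, U k a c * star (U k b e) = if a = b ∧ c = e then K else 0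

/-- The Weyl operator of `k = (g, ψ)`: multiplication by the character `ψ`, then translation by
`g`. -/
def shiftCharacter {G : Type*} [AddCommGroup G] [DecidableEq G] (k : G × AddChar G ℂ) :
    Matrix G G ℂ :=
  Matrix.of fun a c => if a = c + k.1 then k.2 c else 0

section Weyl

variable {G : Type*} [AddCommGroup G] [Fintype G] [DecidableEq G]

theorem shiftCharacter_mem_unitaryGroup (k : G × AddChar G ℂ) :
    shiftCharacter k ∈ Matrix.unitaryGroup G ℂ := by
  rw [Matrix.mem_unitaryGroup_iff']
  ext c e
  rw [Matrix.mul_apply, Finset.sum_eq_single (c + k.1)]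
  · by_cases h : c = e
    · subst h
      simp [shiftCharacter, Complex.conj_mul', AddChar.norm_apply]
    · simp [shiftCharacter, h]
  · intro a _ ha
    simp [shiftCharacter, ha]
  · simp

/-- Orthogonality of the characters of `G`. -/
theorem isOneDesign_shiftCharacter :
    IsOneDesign (shiftCharacter (G := G)) (Fintype.card G : ℂ) := by
  intro a b c e
  have hψ (ψ : AddChar G ℂ) : ψ c * star (ψ e) = ψ (c - e) := by
    rw [RCLike.star_def, ← AddChar.map_neg_eq_conj, ← AddChar.map_add_eq_mul, sub_eq_add_neg]
  rw [Fintype.sum_prod_type]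
  rw [Finset.sum_eq_single (a - c)]
  · by_cases hce : c = e
    · subst hce
      by_cases hab : a = b
      · subst hab
        simp [shiftCharacter, AddChar.card_eq, Complex.mul_conj', AddChar.norm_apply]
      · have : b ≠ a := fun h => hab h.symm
        simp [shiftCharacter, hab, this]
    · by_cases h : b = e + (a - c)
      · have h0 : c - e ≠ 0 := sub_ne_zero.2 hce
        simp only [shiftCharacter, Matrix.of_apply, add_sub_cancel, if_true, ← h, hψ,
          AddChar.sum_apply_eq_ite, h0, if_false, hce, and_false]
      · simp [shiftCharacter, h, hce]
  · intro g _ hg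
    have : a ≠ c + g := fun h => hg (by rw [h, add_sub_cancel_left])
    simp [shiftCharacter, this]
  · simp

end Weyl

theorem IsOneDesign.sum_kronecker_conj {n m κ ι : Type*} [Fintype n] [Fintype m] [DecidableEq n]
    [DecidableEq m] [Fintype κ] [Fintype ι] {U : κ → Matrix n n ℂ} {V : ι → Matrix m m ℂ}
    {K L : ℂ} (hU : IsOneDesign U K) (hV : IsOneDesign V L) (σ : Matrix (n × m) (n × m) ℂ) :
    ∑ k : κ × ι, (U k.1 ⊗ₖ V k.2) * σ * (U k.1 ⊗ₖ V k.2)ᴴ =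
      (K * L * σ.trace) • (1 : Matrix (n × m) (n × m) ℂ) := by
  ext ⟨a, a'⟩ ⟨b, b'⟩
  have h : (∑ k : κ × ι, (U k.1 ⊗ₖ V k.2) * σ * (U k.1 ⊗ₖ V k.2)ᴴ) (a, a') (b, b') =
      ∑ e : n × m, ∑ c : n × m, σ c e * ((∑ k, U k a c.1 * star (U k b e.1)) *
        ∑ l, V l a' c.2 * star (V l b' e.2)) := by
    have hs (e c : n × m) : σ c e * ((∑ k, U k a c.1 * star (U k b e.1)) *
        ∑ l, V l a' c.2 * star (V l b' e.2)) = ∑ k : κ × ι, σ c e *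
          ((U k.1 a c.1 * star (U k.1 b e.1)) * (V k.2 a' c.2 * star (V k.2 b' e.2))) := by
      rw [Finset.sum_mul_sum, ← Fintype.sum_prod_type', Finset.mul_sum]
    simp only [hs]
    rw [Matrix.sum_apply, Finset.sum_congr rfl fun e _ => Finset.sum_comm, Finset.sum_comm]
    refine Finset.sum_congr rfl fun k _ => ?_
    simp only [Matrix.mul_apply, Finset.sum_mul]
    refine Finset.sum_congr rfl fun e _ => Finset.sum_congr rfl fun c _ => ?_
    simp only [Matrix.conjTranspose_apply, Matrix.kroneckerMap_apply, star_mul']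
    ring
  rw [h]
  have hsum (e : n × m) : ∑ c : n × m, σ c e * ((∑ k, U k a c.1 * star (U k b e.1)) *
      ∑ l, V l a' c.2 * star (V l b' e.2)) =
      if a = b ∧ a' = b' then σ e e * (K * L) else 0 := by
    rw [Finset.sum_eq_single e]
    · rw [hU, hV]
      by_cases h1 : a = b <;> by_cases h2 : a' = b' <;> simp [h1, h2]
    · intro c _ hc
      rw [hU, hV]
      have : c.1 ≠ e.1 ∨ c.2 ≠ e.2 := by
        by_contra! h
        exact hc (Prod.ext h.1 h.2)
      rcases this with h | h <;> simp [h]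
    · simp
  simp only [hsum, Matrix.smul_apply, Matrix.one_apply, Prod.mk.injEq, smul_eq_mul]
  split_ifs
  · rw [← Finset.sum_mul, mul_one, mul_comm]
    rfl
  · simp


section Matrices

variable {n : Type*} [Fintype n] [DecidableEq n]

/-! ### Lower bounds for the overlap of square roots -/

theorem posDef_of_rank_eq_card {A : Matrix n n ℂ} (hA : A.PosSemidef)
    (h : A.rank = Fintype.card n) : A.PosDef := by
  refine hA.isHermitian.posDef_iff_eigenvalues_pos.2 fun i =>
    (hA.eigenvalues_nonneg i).lt_of_ne fun h0 => ?_
  rw [hA.isHermitian.rank_eq_card_non_zero_eigs] at h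
  exact (Fintype.card_subtype_lt (p := fun i => hA.isHermitian.eigenvalues i ≠ 0)
    (not_not.2 h0.symm)).ne h

theorem IsState.sum_eigenvalues₀ {ρ : Matrix n n ℂ} (hρ : IsState ρ) :
    ∑ k, hρ.isHermitian.eigenvalues₀ k = 1 := by
  have h := hρ.isHermitian.trace_eq_sum_eigenvalues
  rw [hρ.2] at h
  have h1 : ∑ i, hρ.isHermitian.eigenvalues i = 1 := by
    have := congrArg Complex.re h
    simpa [Complex.re_sum] using this.symm
  rw [← h1]
  exact (Equiv.sum_comp (Fintype.equivOfCardEq (Fintype.card_fin _) : _ ≃ n).symm _).symm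

theorem trace_msqrt_mul_msqrt_unitary_conj {ρ σ W : Matrix n n ℂ} (hρ : ρ.IsHermitian)
    (hσ : σ.IsHermitian) (hW : W ∈ Matrix.unitaryGroup n ℂ) :
    (msqrt ρ * msqrt (W * σ * Wᴴ)).trace.re = ∑ i, ∑ j,
      normSqMatrix ((hρ.eigenvectorUnitary : Matrix n n ℂ)ᴴ *
        (W * (hσ.eigenvectorUnitary : Matrix n n ℂ))) i j *
          (√(hρ.eigenvalues i) * √(hσ.eigenvalues j)) := by
  rw [msqrt, msqrt, cfc_eq_diagonal hρ, cfc_unitary_conj_eq_diagonal hσ hW,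
    trace_conj_diagonal_mul_conj_diagonal]

theorem overlap_mem_doublyStochastic {ρ σ W : Matrix n n ℂ} (hρ : ρ.IsHermitian)
    (hσ : σ.IsHermitian) (hW : W ∈ Matrix.unitaryGroup n ℂ) :
    normSqMatrix ((hρ.eigenvectorUnitary : Matrix n n ℂ)ᴴ *
        (W * (hσ.eigenvectorUnitary : Matrix n n ℂ))) ∈ doublyStochastic ℝ n :=
  normSqMatrix_mem_doublyStochastic (mul_mem (Unitary.star_mem hρ.eigenvectorUnitary.2)
    (mul_mem hW hσ.eigenvectorUnitary.2))

/-- Jensen's inequality for the state `√ρ / Tr √ρ` and the observable `log σ / 2`, followed by the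
rearrangement bound for the expectation. Passing from the spectrum of `√ρ / Tr √ρ` to the more
sharply peaked spectrum of `ρ` lowers the oppositely ordered pairing, by Chebyshev's inequality. -/
theorem trSqrt_mul_exp_le_re_trace {ρ σ W : Matrix n n ℂ} (hρ : IsState ρ) (hσ : σ.PosDef)
    (hW : W ∈ Matrix.unitaryGroup n ℂ) :
    trSqrt ρ * Real.exp ((1 / 2 : ℝ) * ∑ j, eigDown hρ.isHermitian j *
        Real.log (eigUp hσ.isHermitian j)) ≤
      (msqrt ρ * msqrt (W * σ * Wᴴ)).trace.re := by
  have hP := overlap_mem_doublyStochastic hρ.isHermitian hσ.isHermitian hW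
  rw [trace_msqrt_mul_msqrt_unitary_conj hρ.isHermitian hσ.isHermitian hW]
  generalize normSqMatrix _ = P at hP ⊢
  let e : n ≃ Fin (Fintype.card n) := (Fintype.equivOfCardEq (Fintype.card_fin _)).symm
  let q : Fin (Fintype.card n) → ℝ := fun k => √(hρ.isHermitian.eigenvalues₀ k)
  let x : Fin (Fintype.card n) → ℝ := fun k => Real.log (hσ.isHermitian.eigenvalues₀ k)
  have hp0 (k) : 0 ≤ hρ.isHermitian.eigenvalues₀ k := by
    have := hρ.1.eigenvalues_nonneg (e.symm k)
    change 0 ≤ hρ.isHermitian.eigenvalues₀ (e (e.symm k)) at this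
    rwa [e.apply_symm_apply] at this
  have hs0 (k) : 0 < hσ.isHermitian.eigenvalues₀ k := by
    have := hσ.eigenvalues_pos (e.symm k)
    change 0 < hσ.isHermitian.eigenvalues₀ (e (e.symm k)) at this
    rwa [e.apply_symm_apply] at this
  have hq0 (k) : 0 ≤ q k := Real.sqrt_nonneg _
  have hq2 (k) : q k ^ 2 = hρ.isHermitian.eigenvalues₀ k := Real.sq_sqrt (hp0 k)
  have hq : Antitone q := fun a b hab =>
    Real.sqrt_le_sqrt (hρ.isHermitian.eigenvalues₀_antitone hab)
  have hx : Antitone x := fun a b hab =>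
    Real.log_le_log (hs0 b) (hσ.isHermitian.eigenvalues₀_antitone hab)
  have hqq : ∑ k, q k ^ 2 = 1 := by
    simp only [hq2]
    exact hρ.sum_eigenvalues₀
  have hZ : trSqrt ρ = ∑ k, q k := by
    rw [trSqrt_eq_sum hρ.isHermitian]
    exact e.sum_comp q
  have hZ0 : 0 < ∑ k, q k := by
    refine (Finset.sum_nonneg fun k _ => hq0 k).lt_of_ne fun h => ?_
    have := (Finset.sum_eq_zero_iff_of_nonneg fun k _ => hq0 k).1 h.symm
    rw [Finset.sum_eq_zero fun k hk => by rw [this k hk]; norm_num] at hqq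
    norm_num at hqq
  have hcheb : (∑ k, q k) * ∑ k, eigDown hρ.isHermitian k * Real.log (eigUp hσ.isHermitian k) ≤
      ∑ k, q k * x k.rev := by
    have hm : Monotone fun k : Fin (Fintype.card n) => x k.rev :=
      fun a b hab => hx (Fin.rev_le_rev.2 hab)
    have := sum_mul_sum_sq_mul_le_of_antivary hq0 (hq.antivary hm)
    rw [hqq, one_mul] at this
    simp only [hq2] at this
    exact this
  have hrear := sum_mul_rev_le_of_mem_doublyStochastic hP e hq hx
  have hw1 : ∑ i, ∑ j, P i j * q (e i) / (∑ k, q k) = 1 := by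
    simp only [← Finset.sum_div, ← Finset.sum_mul, sum_row_of_mem_doublyStochastic hP, one_mul]
    rw [e.sum_comp q, div_self hZ0.ne']
  have hjen := exp_sum_sum_le (x := fun _ j => 1 / 2 * x (e j))
    (fun i j => div_nonneg (mul_nonneg (nonneg_of_mem_doublyStochastic hP) (hq0 _)) hZ0.le) hw1
  rw [hZ]
  calc (∑ k, q k) * Real.exp ((1 / 2 : ℝ) * ∑ j, eigDown hρ.isHermitian j *
        Real.log (eigUp hσ.isHermitian j))
      ≤ (∑ k, q k) * Real.exp (∑ i, ∑ j, P i j * q (e i) / (∑ k, q k) * (1 / 2 * x (e j))) := by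
        refine mul_le_mul_of_nonneg_left (Real.exp_le_exp.2 ?_) hZ0.le
        have h : ∑ i, ∑ j, P i j * q (e i) / (∑ k, q k) * (1 / 2 * x (e j)) =
            1 / 2 * ((∑ i, ∑ j, P i j * (q (e i) * x (e j))) / ∑ k, q k) := by
          simp only [Finset.sum_div, Finset.mul_sum]
          exact Finset.sum_congr rfl fun i _ => Finset.sum_congr rfl fun j _ => by ring
        rw [h]
        refine mul_le_mul_of_nonneg_left ((le_div_iff₀' hZ0).2 (hcheb.trans hrear)) (by norm_num)
    _ ≤ (∑ k, q k) * ∑ i, ∑ j, P i j * q (e i) / (∑ k, q k) * Real.exp (1 / 2 * x (e j)) :=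
        mul_le_mul_of_nonneg_left hjen hZ0.le
    _ = _ := by
        rw [Finset.mul_sum]
        refine Finset.sum_congr rfl fun i _ => ?_
        rw [Finset.mul_sum]
        refine Finset.sum_congr rfl fun j _ => ?_
        rw [sqrt_eq_exp_half_log (hσ.eigenvalues_pos j)]
        change _ = P i j * (q (e i) * Real.exp (1 / 2 * x (e j)))
        field_simp

theorem relEntropy_unitary_conj {ρ σ W : Matrix n n ℂ} (hρ : ρ.IsHermitian)
    (hσ : σ.IsHermitian) (hW : W ∈ Matrix.unitaryGroup n ℂ) :
    relEntropy ρ (W * σ * Wᴴ) = ∑ i, ∑ j,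
      normSqMatrix ((hρ.eigenvectorUnitary : Matrix n n ℂ)ᴴ *
        (W * (hσ.eigenvectorUnitary : Matrix n n ℂ))) i j * hρ.eigenvalues i *
          (Real.log (hρ.eigenvalues i) - Real.log (hσ.eigenvalues j)) := by
  have hP := overlap_mem_doublyStochastic hρ hσ hW
  have h1 : (ρ * mlog ρ).trace.re = ∑ i, hρ.eigenvalues i * Real.log (hρ.eigenvalues i) := by
    rw [mlog, cfc_eq_diagonal hρ]
    conv_lhs => enter [1, 1, 1]; rw [eq_diagonal hρ]
    rw [trace_conj_diagonal_mul_conj_diagonal, ← Matrix.star_eq_conjTranspose,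
      Matrix.mem_unitaryGroup_iff'.1 hρ.eigenvectorUnitary.2]
    refine Finset.sum_congr rfl fun i _ => ?_
    rw [Finset.sum_eq_single i]
    · simp [normSqMatrix]
    · intro j _ hj
      simp [normSqMatrix, Matrix.one_apply_ne hj.symm]
    · simp
  have h2 := trace_conj_diagonal_mul_conj_diagonal (hρ.eigenvectorUnitary : Matrix n n ℂ)
    (W * (hσ.eigenvectorUnitary : Matrix n n ℂ)) hρ.eigenvalues
    (fun j => Real.log (hσ.eigenvalues j))
  rw [← eq_diagonal hρ, ← cfc_unitary_conj_eq_diagonal hσ hW] at h2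
  rw [relEntropy, Matrix.mul_sub, Matrix.trace_sub, Complex.sub_re, h1, mlog, h2]
  generalize normSqMatrix _ = P at hP ⊢
  rw [← Finset.sum_sub_distrib]
  refine Finset.sum_congr rfl fun i _ => ?_
  simp only [mul_sub, Finset.sum_sub_distrib, ← Finset.sum_mul,
    sum_row_of_mem_doublyStochastic hP, one_mul, mul_assoc]

/-- Writing `√p * √s = p * exp (-(log p - log s) / 2)`, the overlap of the square roots is the
average of an exponential, whose exponent averages to `-S / 2`. -/
theorem exp_neg_relEntropy_le_re_trace {ρ σ W : Matrix n n ℂ} (hρ : IsState ρ) (hρ' : ρ.PosDef)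
    (hσ : σ.PosDef) (hW : W ∈ Matrix.unitaryGroup n ℂ) :
    Real.exp (-(1 / 2 : ℝ) * relEntropy ρ (W * σ * Wᴴ)) ≤
      (msqrt ρ * msqrt (W * σ * Wᴴ)).trace.re := by
  have hP := overlap_mem_doublyStochastic hρ.isHermitian hσ.isHermitian hW
  rw [trace_msqrt_mul_msqrt_unitary_conj hρ.isHermitian hσ.isHermitian hW,
    relEntropy_unitary_conj hρ.isHermitian hσ.isHermitian hW]
  generalize normSqMatrix _ = P at hP ⊢
  have hp (i) : 0 < hρ.isHermitian.eigenvalues i := hρ'.eigenvalues_pos i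
  have hs (j) : 0 < hσ.isHermitian.eigenvalues j := hσ.eigenvalues_pos j
  have hw1 : ∑ i, ∑ j, P i j * hρ.isHermitian.eigenvalues i = 1 := by
    simp only [← Finset.sum_mul, sum_row_of_mem_doublyStochastic hP, one_mul]
    rw [← hρ.sum_eigenvalues₀]
    exact Equiv.sum_comp (Fintype.equivOfCardEq (Fintype.card_fin _) : _ ≃ n).symm _
  have hjen := exp_sum_sum_le (x := fun i j => -(1 / 2 : ℝ) *
      (Real.log (hρ.isHermitian.eigenvalues i) - Real.log (hσ.isHermitian.eigenvalues j)))
    (fun i j => mul_nonneg (nonneg_of_mem_doublyStochastic hP) (hp i).le) hw1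
  convert hjen using 1
  · simp only [Finset.mul_sum]
    congr 1
    exact Finset.sum_congr rfl fun i _ => Finset.sum_congr rfl fun j _ => by ring
  · refine Finset.sum_congr rfl fun i _ => Finset.sum_congr rfl fun j _ => ?_
    rw [mul_assoc, mul_sub, Real.exp_sub, sqrt_eq_exp_half_log (hs j), neg_mul, neg_mul,
      Real.exp_neg, Real.exp_neg, ← sqrt_eq_exp_half_log (hp i)]
    have : 0 < √(hρ.isHermitian.eigenvalues i) := Real.sqrt_pos.2 (hp i)
    conv_rhs => enter [2, 1]; rw [← Real.mul_self_sqrt (hp i).le]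
    field_simp

end Matrices

/-! ### Optimization over local unitaries -/

section Local

variable {d₁ d₂ : ℕ}

theorem kronecker_mem_unitaryGroup
    (U : Matrix.unitaryGroup (Fin d₁) ℂ × Matrix.unitaryGroup (Fin d₂) ℂ) :
    ((U.1 : Matrix (Fin d₁) (Fin d₁) ℂ) ⊗ₖ (U.2 : Matrix (Fin d₂) (Fin d₂) ℂ)) ∈
      Matrix.unitaryGroup (Fin d₁ × Fin d₂) ℂ :=
  Matrix.kronecker_mem_unitary U.1.2 U.2.2

theorem posSemidef_localConj
    (U : Matrix.unitaryGroup (Fin d₁) ℂ × Matrix.unitaryGroup (Fin d₂) ℂ)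
    {σ : Matrix (Fin d₁ × Fin d₂) (Fin d₁ × Fin d₂) ℂ} (hσ : σ.PosSemidef) :
    (localConj U σ).PosSemidef :=
  hσ.mul_mul_conjTranspose_same _

theorem continuous_localConj (σ : Matrix (Fin d₁ × Fin d₂) (Fin d₁ × Fin d₂) ℂ) :
    Continuous fun U : Matrix.unitaryGroup (Fin d₁) ℂ × Matrix.unitaryGroup (Fin d₂) ℂ =>
      localConj U σ := by
  have h : Continuous fun U : Matrix.unitaryGroup (Fin d₁) ℂ × Matrix.unitaryGroup (Fin d₂) ℂ =>
      (U.1 : Matrix (Fin d₁) (Fin d₁) ℂ) ⊗ₖ (U.2 : Matrix (Fin d₂) (Fin d₂) ℂ) := by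
    refine continuous_matrix fun i j => ?_
    simp only [Matrix.kroneckerMap_apply]
    exact ((continuous_subtype_val.comp continuous_fst).matrix_elem _ _).mul
      ((continuous_subtype_val.comp continuous_snd).matrix_elem _ _)
  exact (h.mul continuous_const).mul h.matrix_conjTranspose

theorem isLeast_Gmin {ρ σ : Matrix (Fin d₁ × Fin d₂) (Fin d₁ × Fin d₂) ℂ}
    (hσ : σ.PosSemidef) : IsLeast (fidelityValues ρ σ) (Gmin ρ σ) := by
  have hc : Continuous fun U : Matrix.unitaryGroup (Fin d₁) ℂ × Matrix.unitaryGroup (Fin d₂) ℂ =>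
      fidelity ρ (localConj U σ) :=
    continuous_trSqrt_comp ((continuous_const.mul (continuous_localConj σ)).mul continuous_const)
      fun U => (posSemidef_msqrt_mul_mul_msqrt ρ (posSemidef_localConj U hσ)).isHermitian
  exact (isCompact_range hc).isLeast_sInf (Set.range_nonempty _)

theorem isGreatest_maxRelEntropy {ρ σ : Matrix (Fin d₁ × Fin d₂) (Fin d₁ × Fin d₂) ℂ}
    (hσ : σ.IsHermitian) : IsGreatest (relEntropyValues ρ σ) (maxRelEntropy ρ σ) := by
  have hlog (U : Matrix.unitaryGroup (Fin d₁) ℂ × Matrix.unitaryGroup (Fin d₂) ℂ) :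
      mlog (localConj U σ) = localConj U (mlog σ) :=
    cfc_unitary_conj hσ (kronecker_mem_unitaryGroup U) Real.log
  have hc : Continuous fun U : Matrix.unitaryGroup (Fin d₁) ℂ × Matrix.unitaryGroup (Fin d₂) ℂ =>
      relEntropy ρ (localConj U σ) := by
    simp only [relEntropy, hlog]
    exact Complex.continuous_re.comp (continuous_const.mul
      (continuous_const.sub (continuous_localConj (mlog σ)))).matrix_trace
  exact (isCompact_range hc).isGreatest_sSup (Set.range_nonempty _)

theorem fidelityValues_subset_swap {ρ σ : Matrix (Fin d₁ × Fin d₂) (Fin d₁ × Fin d₂) ℂ}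
    (hρ : ρ.PosSemidef) (hσ : σ.PosSemidef) : fidelityValues ρ σ ⊆ fidelityValues σ ρ := by
  rintro _ ⟨U, rfl⟩
  refine ⟨U⁻¹, fidelity_eq_of_charpoly_eq hσ (posSemidef_localConj _ hρ) hρ
    (posSemidef_localConj _ hσ) ?_⟩
  have h : ((U⁻¹.1 : Matrix (Fin d₁) (Fin d₁) ℂ) ⊗ₖ (U⁻¹.2 : Matrix (Fin d₂) (Fin d₂) ℂ)) =
      ((U.1 : Matrix (Fin d₁) (Fin d₁) ℂ) ⊗ₖ (U.2 : Matrix (Fin d₂) (Fin d₂) ℂ))ᴴ := by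
    rw [Matrix.conjTranspose_kronecker]
    rfl
  rw [localConj, localConj, h, Matrix.conjTranspose_conjTranspose]
  generalize (U.1 : Matrix (Fin d₁) (Fin d₁) ℂ) ⊗ₖ (U.2 : Matrix (Fin d₂) (Fin d₂) ℂ) = W
  rw [Matrix.mul_assoc, ← Matrix.mul_assoc, Matrix.charpoly_mul_comm, Matrix.mul_assoc,
    Matrix.mul_assoc W]

theorem Gmin_comm {ρ σ : Matrix (Fin d₁ × Fin d₂) (Fin d₁ × Fin d₂) ℂ}
    (hρ : ρ.PosSemidef) (hσ : σ.PosSemidef) : Gmin ρ σ = Gmin σ ρ := by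
  rw [Gmin, Gmin, (fidelityValues_subset_swap hρ hσ).antisymm (fidelityValues_subset_swap hσ hρ)]

/-- By concavity the least fidelity is at most the fidelity with the average of
`(U₁ ⊗ U₂) σ (U₁ ⊗ U₂)†` over a product of unitary designs, which is maximally mixed. -/
theorem Gmin_le_trSqrt_div {ρ σ : Matrix (Fin d₁ × Fin d₂) (Fin d₁ × Fin d₂) ℂ}
    (hρ : ρ.PosSemidef) (hσ : IsState σ) :
    Gmin ρ σ ≤ trSqrt ρ / √((d₁ : ℝ) * (d₂ : ℝ)) := by
  -- In dimension zero there is no matrix of trace one.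
  have hd : d₁ ≠ 0 ∧ d₂ ≠ 0 := by
    constructor <;> rintro rfl <;> simpa [Matrix.trace] using hσ.2
  have : NeZero d₁ := ⟨hd.1⟩
  have : NeZero d₂ := ⟨hd.2⟩
  have hd₁ : (0 : ℝ) < d₁ := Nat.cast_pos.2 hd.1.bot_lt
  have hd₂ : (0 : ℝ) < d₂ := Nat.cast_pos.2 hd.2.bot_lt
  let κ := (Fin d₁ × AddChar (Fin d₁) ℂ) × (Fin d₂ × AddChar (Fin d₂) ℂ)
  let U : κ → Matrix.unitaryGroup (Fin d₁) ℂ × Matrix.unitaryGroup (Fin d₂) ℂ := fun k =>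
    (⟨shiftCharacter k.1, shiftCharacter_mem_unitaryGroup k.1⟩,
      ⟨shiftCharacter k.2, shiftCharacter_mem_unitaryGroup k.2⟩)
  let w : ℝ := (((d₁ : ℝ) * d₂) ^ 2)⁻¹
  have hw : ∑ _k : κ, w = 1 := by
    simp only [Finset.sum_const, Finset.card_univ, κ, Fintype.card_prod, AddChar.card_eq,
      Fintype.card_fin, nsmul_eq_mul, w]
    push_cast
    field_simp
  have hsum : ∑ k, localConj (U k) σ = ((d₁ : ℝ) * d₂) • (1 : Matrix _ _ ℂ) := by
    have h := IsOneDesign.sum_kronecker_conj (isOneDesign_shiftCharacter (G := Fin d₁))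
      (isOneDesign_shiftCharacter (G := Fin d₂)) σ
    rw [hσ.2, mul_one, Fintype.card_fin, Fintype.card_fin] at h
    refine h.trans ?_
    ext i j
    simp
  have hmean : ∑ k, w • (msqrt ρ * localConj (U k) σ * msqrt ρ) =
      ((d₁ : ℝ) * d₂)⁻¹ • ρ := by
    rw [← Finset.smul_sum, ← Matrix.sum_mul, ← Matrix.mul_sum, hsum, Matrix.mul_smul,
      Matrix.mul_one, Matrix.smul_mul, msqrt_mul_msqrt hρ, smul_smul]
    congr 1
    simp only [w]
    field_simp
  calc Gmin ρ σ = ∑ _k : κ, w * Gmin ρ σ := by rw [← Finset.sum_mul, hw, one_mul]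
    _ ≤ ∑ k, w * trSqrt (msqrt ρ * localConj (U k) σ * msqrt ρ) :=
        Finset.sum_le_sum fun k _ => mul_le_mul_of_nonneg_left
          ((isLeast_Gmin hσ.1).2 ⟨U k, rfl⟩) (by positivity)
    _ ≤ trSqrt (∑ k, w • (msqrt ρ * localConj (U k) σ * msqrt ρ)) :=
        sum_mul_trSqrt_le (fun _ => by positivity) hw
          fun k => posSemidef_msqrt_mul_mul_msqrt ρ (posSemidef_localConj _ hσ.1)
    _ = _ := by
        rw [hmean, trSqrt_smul hρ.isHermitian (by positivity), Real.sqrt_inv]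
        ring

theorem trSqrt_mul_exp_le_Gmin {ρ σ : Matrix (Fin d₁ × Fin d₂) (Fin d₁ × Fin d₂) ℂ}
    (hρ : IsState ρ) (hσ : σ.PosDef) :
    trSqrt ρ * Real.exp ((1 / 2 : ℝ) * ∑ j, eigDown hρ.isHermitian j *
        Real.log (eigUp hσ.isHermitian j)) ≤ Gmin ρ σ := by
  obtain ⟨U, hU⟩ := (isLeast_Gmin (ρ := ρ) hσ.posSemidef).1
  rw [← hU]
  exact (trSqrt_mul_exp_le_re_trace hρ hσ (kronecker_mem_unitaryGroup U)).trans
    (re_trace_msqrt_mul_msqrt_le_fidelity ρ (posSemidef_localConj U hσ.posSemidef))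

theorem exp_neg_maxRelEntropy_le_Gmin {ρ σ : Matrix (Fin d₁ × Fin d₂) (Fin d₁ × Fin d₂) ℂ}
    (hρ : IsState ρ) (hρ' : ρ.PosDef) (hσ : σ.PosDef) :
    Real.exp (-(1 / 2 : ℝ) * maxRelEntropy ρ σ) ≤ Gmin ρ σ := by
  obtain ⟨U, hU⟩ := (isLeast_Gmin (ρ := ρ) hσ.posSemidef).1
  rw [← hU]
  have hmax : relEntropy ρ (localConj U σ) ≤ maxRelEntropy ρ σ :=
    (isGreatest_maxRelEntropy hσ.isHermitian).2 ⟨U, rfl⟩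
  refine (Real.exp_le_exp.2 (mul_le_mul_of_nonpos_left hmax (by norm_num))).trans ?_
  exact (exp_neg_relEntropy_le_re_trace hρ hρ' hσ (kronecker_mem_unitaryGroup U)).trans
    (re_trace_msqrt_mul_msqrt_le_fidelity ρ (posSemidef_localConj U hσ.posSemidef))

end Local

end LocalUnitary

theorem mainTheorem8 (d₁ d₂ : ℕ)
    (ρ σ : Matrix (Fin d₁ × Fin d₂) (Fin d₁ × Fin d₂) ℂ)
    (hρ : LocalUnitary.IsState ρ) (hσ : LocalUnitary.IsState σ) :
    -- the minimum defining `G_min` is attained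
    IsLeast (LocalUnitary.fidelityValues ρ σ) (LocalUnitary.Gmin ρ σ) ∧
    -- upper bound
    LocalUnitary.Gmin ρ σ ≤
      min (LocalUnitary.trSqrt ρ) (LocalUnitary.trSqrt σ) / Real.sqrt ((d₁ : ℝ) * (d₂ : ℝ)) ∧
    -- lower bound, for full-rank states
    (ρ.rank = d₁ * d₂ → σ.rank = d₁ * d₂ →
      IsGreatest (LocalUnitary.relEntropyValues ρ σ) (LocalUnitary.maxRelEntropy ρ σ) ∧
      max
        (max
          (LocalUnitary.trSqrt ρ * Real.exp ((1 / 2 : ℝ) * ∑ j,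
            LocalUnitary.eigDown hρ.isHermitian j *
              Real.log (LocalUnitary.eigUp hσ.isHermitian j)))
          (LocalUnitary.trSqrt σ * Real.exp ((1 / 2 : ℝ) * ∑ j,
            LocalUnitary.eigDown hσ.isHermitian j *
              Real.log (LocalUnitary.eigUp hρ.isHermitian j))))
        (Real.exp (-(1 / 2 : ℝ) * LocalUnitary.maxRelEntropy ρ σ)) ≤
        LocalUnitary.Gmin ρ σ) := by
  refine ⟨LocalUnitary.isLeast_Gmin hσ.1, ?_, fun hρr hσr => ?_⟩
  · rw [← min_div_div_right (Real.sqrt_nonneg _)]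
    refine le_min (LocalUnitary.Gmin_le_trSqrt_div hρ.1 hσ) ?_
    rw [LocalUnitary.Gmin_comm hρ.1 hσ.1]
    exact LocalUnitary.Gmin_le_trSqrt_div hσ.1 hρ
  · have hρp : ρ.PosDef := LocalUnitary.posDef_of_rank_eq_card hρ.1 (by simpa using hρr)
    have hσp : σ.PosDef := LocalUnitary.posDef_of_rank_eq_card hσ.1 (by simpa using hσr)
    refine ⟨LocalUnitary.isGreatest_maxRelEntropy hσ.isHermitian,
      max_le (max_le (LocalUnitary.trSqrt_mul_exp_le_Gmin hρ hσp) ?_)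
        (LocalUnitary.exp_neg_maxRelEntropy_le_Gmin hρ hρp hσp)⟩
    rw [LocalUnitary.Gmin_comm hρ.1 hσ.1]
    exact LocalUnitary.trSqrt_mul_exp_le_Gmin hσ hρp
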